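/- Fix $d\ge 1$. A *box* in $\mathbb{R}^d$ is a set $[a_1,b_1]\times\dots\times[a_d,b_d]$ with integers $a_i<b_i$; its side lengths are the $b_i-a_i$, its center is the point with coordinates $(a_i+b_i)/2$, and it is a *square box* if all its side lengths are equal. A *partition* is a finite collection $\mathcal C$ of boxes with pairwise disjoint interiors whose union is $[0,n]^d$ for some integer $n>0$; it is *cubical* if all its boxes are square boxes. For $0<\varepsilon<2/d$ put $T_\varepsilon x=\bigl(x_1-\tfrac{\varepsilon}{2}\sum_j x_j,\dots,x_d-\tfrac{\varepsilon}{2}\sum_j x_j\bigr)$. The *distortion* of a unit box $z+[0,1]^d$, $z\in\mathbb{Z}^d$, is the Voronoi cell of the site $T_\varepsilon\bigl(z+(\tfrac12,\dots,\tfrac12)\bigr)$ in the Voronoi diagram of the set of sites $\{T_\varepsilon(z'+(\tfrac12,\dots,\tfrac12)) : z'\in\mathbb{Z}^d\}$, and the distortion of a box is the union of the distortions of the unit boxes contained in it. The *dual complex* $D_\varepsilon(\mathcal C)$ is the nerve of the distorted boxes: its vertices are the boxes of $\mathcal C$, and a nonempty set of boxes is a simplex if and only if their distortions have a common point. For $\beta\ge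 1$, $\mathcal C$ is *$\beta$-balanced* (with respect to $\varepsilon$) if for every simplex $\sigma$ of $D_\varepsilon(\mathcal C)$ the longest side length among all boxes of $\sigma$ divided by the shortest side length among all boxes of $\sigma$ is at most $\beta$. $\mathcal C$ is *center-embeddable* (with respect to $\varepsilon$) if the map from the geometric realization of $D_\varepsilon(\mathcal C)$ to $\mathbb{R}^d$ that sends each vertex to the center of its box and is affine on each simplex is injective. **Theorem.** For every integer $d\ge 3$ and every real $\beta>\frac{d}{d-2}$ there exists a cubical partition $\mathcal C$ in $\mathbb{R}^d$ such that, for every $\varepsilon\in(0,2/d)$, $\mathcal C$ is $\beta$-balanced and is not center-embeddable. -/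

import Mathlib

namespace CubicalDual

/-- An integral hyper-rectangle `[lo₁, hi₁] × ⋯ × [lo_d, hi_d]` with integer `lo i < hi i`. -/
@[ext]
structure Box (d : ℕ) where
  lo : Fin d → ℤ
  hi : Fin d → ℤ
  lo_lt_hi : ∀ i, lo i < hi i

namespace Box

variable {d : ℕ}

/-- The closed point set in `ℝ^d` that a box describes. -/
def toSet (R : Box d) : Set (EuclideanSpace ℝ (Fin d)) :=
  {x | ∀ i, (R.lo i : ℝ) ≤ x i ∧ x i ≤ (R.hi i : ℝ)}

/-- The side length of a box in direction `i`. -/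
def length (R : Box d) (i : Fin d) : ℝ := (R.hi i : ℝ) - (R.lo i : ℝ)

/-- A square box: all side lengths are equal. -/
def IsSquare (R : Box d) : Prop := ∀ i j, R.length i = R.length j

/-- The center of a box. -/
noncomputable def center (R : Box d) : EuclideanSpace ℝ (Fin d) :=
  WithLp.toLp 2 fun i => ((R.lo i : ℝ) + (R.hi i : ℝ)) / 2

/-- The unit box `[z₁, z₁ + 1] × ⋯ × [z_d, z_d + 1]`. -/
def pixel (z : Fin d → ℤ) : Box d where
  lo := z
  hi := fun i => z i + 1
  lo_lt_hi := fun i => lt_add_one (z i)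

end Box

variable {d : ℕ}

/-- The square box `[0, n]^d`, as a point set. -/
def bigCube (d n : ℕ) : Set (EuclideanSpace ℝ (Fin d)) :=
  {x | ∀ i, 0 ≤ x i ∧ x i ≤ (n : ℝ)}

/-- A hyper-rectangular partition of `[0, n]^d`: finitely many boxes with pairwise disjoint
interiors whose union is `[0, n]^d`. -/
structure IsPartition (n : ℕ) (C : Finset (Box d)) : Prop where
  iUnion_eq : ⋃ R ∈ C, R.toSet = bigCube d n
  disjoint : ∀ R ∈ C, ∀ R' ∈ C, R ≠ R' → Disjoint (interior R.toSet) (interior R'.toSet)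

/-- A partition is cubical if all its boxes are square boxes. -/
def IsCubical (C : Finset (Box d)) : Prop := ∀ R ∈ C, R.IsSquare

/-- The distortion `T_ε x = (x₁ - ε (∑ xⱼ) / 2, …, x_d - ε (∑ xⱼ) / 2)`. -/
noncomputable def distort (ε : ℝ) (x : EuclideanSpace ℝ (Fin d)) : EuclideanSpace ℝ (Fin d) :=
  WithLp.toLp 2 fun i => x i - ε * ((∑ j, x j) / 2)

/-- The distorted pixel: the Voronoi cell of the distorted center of the pixel at `z`, among the
distorted centers of all pixels of `ℝ^d`. -/
def distortedPixel (ε : ℝ) (z : Fin d → ℤ) : Set (EuclideanSpace ℝ (Fin d)) :=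
  {x | ∀ z' : Fin d → ℤ,
    dist x (distort ε (Box.pixel z).center) ≤ dist x (distort ε (Box.pixel z').center)}

/-- The distorted box: the union of the distortions of all pixels contained in the box. -/
def distortedBox (ε : ℝ) (R : Box d) : Set (EuclideanSpace ℝ (Fin d)) :=
  {x | ∃ z : Fin d → ℤ, (Box.pixel z).toSet ⊆ R.toSet ∧ x ∈ distortedPixel ε z}

/-- The dual complex: the nerve of the distorted boxes. A vertex is a box of `C`; a nonempty set of
boxes of `C` is a simplex if the distorted boxes have a common point. -/
def dualComplex (ε : ℝ) (C : Finset (Box d)) : PreAbstractSimplicialComplex (Box d) where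
  faces := {σ | σ.Nonempty ∧ σ ⊆ C ∧ (⋂ R ∈ σ, distortedBox ε R).Nonempty}
  isRelLowerSet_faces := by
    rintro σ ⟨hne, hC, x, hx⟩
    refine ⟨hne, fun τ hτ hτne => ⟨hτne, hτ.trans hC, x, ?_⟩⟩
    simp only [Set.mem_iInter] at hx ⊢
    exact fun R hR => hx R (hτ hR)

/-- The balance of a set of boxes: the length of the longest side among all its boxes divided by
the length of the shortest side among all its boxes. -/
noncomputable def balance (σ : Finset (Box d)) : ℝ :=
  sSup {l : ℝ | ∃ R ∈ σ, ∃ i, R.length i = l} / sInf {l : ℝ | ∃ R ∈ σ, ∃ i, R.length i = l}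

/-- `β`-balanced: every simplex of the dual complex has balance at most `β`. -/
def IsBalanced (ε β : ℝ) (C : Finset (Box d)) : Prop :=
  ∀ σ ∈ (dualComplex ε C).faces, balance σ ≤ β

/-- The geometric realization of an abstract simplicial complex, in barycentric coordinates. -/
def realization {V : Type*} (K : PreAbstractSimplicialComplex V) : Set (V →₀ ℝ) :=
  {w | (∀ v, 0 ≤ w v) ∧ (w.sum fun _ t => t) = 1 ∧ w.support ∈ K.faces}

/-- A placement `π` of the vertices is an embedding of `K` if its extension to the geometric
realization, affine on each simplex, is injective. -/
def IsEmbeddingOf {V : Type*} (K : PreAbstractSimplicialComplex V)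
    (π : V → EuclideanSpace ℝ (Fin d)) : Prop :=
  Set.InjOn (fun w : V →₀ ℝ => w.sum fun v t => t • π v) (realization K)

/-- `C` is center-embeddable if placing each vertex of the dual complex at the center of its box
gives an embedding. -/
def CenterEmbeddable (ε : ℝ) (C : Finset (Box d)) : Prop :=
  IsEmbeddingOf (dualComplex ε C) Box.center

end CubicalDual

/-!
Around an interior lattice point `o`, sort the pixels by the first direction in which they lie above
`o`. This yields `d + 1` regions, and region `k` is divided by a cubical grid of mesh `L k`. With
pairwise coprime meshes, the Chinese remainder theorem supplies an `o` at which every grid has walls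
along the boundary of its region, while the grids of the earlier regions are shifted by one unit in
the later directions. The cubes of regions `0, …, d - 1` at `o` are large, the one of region `d` is
small, and the ratio of their sides lies between `d / (d - 2)` and `β`.

The distorted pixels along a monotone lattice path `o = z₀, z₁, …, z_d = o - (1, …, 1)` share a
point for every `ε` in `(0, 2 / d)`, and the cubes containing them, one from each region, form a
simplex of the dual complex. Dropping `z_d` and prepending `o + e_d` to the path replaces the small
cube by the translate of the first large cube by one mesh in the last direction. The two simplices
share the facet of the `d` large cubes at `o`. As the ratio exceeds `d / (d - 2)`, the center of the
small cube and that of the translate lie on the same side of the hyperplane through the centers of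
this facet, so the simplices overlap.
-/

namespace CubicalDual

section AffineDependence

variable {V : Type*} {d : ℕ} {K : PreAbstractSimplicialComplex V}
  {π : V → EuclideanSpace ℝ (Fin d)}

theorem degree_pos {w : V →₀ ℝ} (hw : ∀ v, 0 ≤ w v) (hw0 : w ≠ 0) : 0 < w.degree :=
  Finset.sum_pos (fun v hv => (hw v).lt_of_ne' (Finsupp.mem_support_iff.1 hv))
    (Finsupp.support_nonempty_iff.2 hw0)

theorem inv_degree_smul_mem_realization {w : V →₀ ℝ} {σ : Finset V} (hw : ∀ v, 0 ≤ w v)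
    (hw0 : w ≠ 0) (hσ : σ ∈ K.faces) (hwσ : w.support ⊆ σ) :
    w.degree⁻¹ • w ∈ realization K := by
  have hpos := degree_pos hw hw0
  refine ⟨fun v => mul_nonneg (inv_nonneg.2 hpos.le) (hw v), ?_, ?_⟩
  · rw [Finsupp.sum_smul_index fun _ => rfl, Finsupp.sum, ← Finset.mul_sum,
      ← Finsupp.degree_apply, inv_mul_cancel₀ hpos.ne']
  · rw [Finsupp.support_smul_eq (inv_ne_zero hpos.ne')]
    exact (K.isRelLowerSet_faces hσ).2 hwσ (Finsupp.support_nonempty_iff.2 hw0)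

/-- This is Radon's argument: after normalization, the positive and the negative part of the
dependence are two points of the realization with the same image. -/
theorem not_isEmbeddingOf_of_affine_dependence {x : V →₀ ℝ} (hx : x ≠ 0) (hdeg : x.degree = 0)
    (hπ : Finsupp.linearCombination ℝ π x = 0) {σ τ : Finset V} (hσ : σ ∈ K.faces)
    (hτ : τ ∈ K.faces) (hpos : ∀ v, 0 < x v → v ∈ σ) (hneg : ∀ v, x v < 0 → v ∈ τ) :
    ¬ IsEmbeddingOf K π := by
  intro hinj
  have hx_eq : x⁺ - x⁻ = x := posPart_sub_negPart x
  have hdeg_eq : x⁺.degree = x⁻.degree := by rw [← sub_eq_zero, ← map_sub, hx_eq, hdeg]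
  have hnonneg_pos : ∀ v, 0 ≤ x⁺ v := fun v => posPart_nonneg (x v)
  have hnonneg_neg : ∀ v, 0 ≤ x⁻ v := fun v => negPart_nonneg (x v)
  have hparts : x⁺ ≠ x⁻ := fun h => hx (by rw [← hx_eq, h, sub_self])
  have hpos_ne : x⁺ ≠ 0 := fun h => by
    refine (degree_pos hnonneg_neg fun h' => hparts (h.trans h'.symm)).ne' ?_
    rw [← hdeg_eq, h, map_zero]
  have hneg_ne : x⁻ ≠ 0 := fun h => by
    refine (degree_pos hnonneg_pos hpos_ne).ne' ?_
    rw [hdeg_eq, h, map_zero]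
  have hsupp_pos : x⁺.support ⊆ σ := fun v hv => hpos v <| not_le.1 fun hle =>
    Finsupp.mem_support_iff.1 hv (posPart_of_nonpos (a := x v) hle)
  have hsupp_neg : x⁻.support ⊆ τ := fun v hv => hneg v <| not_le.1 fun hle =>
    Finsupp.mem_support_iff.1 hv (negPart_of_nonneg (a := x v) hle)
  have himage : Finsupp.linearCombination ℝ π (x⁺.degree⁻¹ • x⁺) =
      Finsupp.linearCombination ℝ π (x⁻.degree⁻¹ • x⁻) := by
    rw [map_smul, map_smul, hdeg_eq, ← sub_eq_zero, ← smul_sub, ← map_sub, hx_eq, hπ, smul_zero]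
  have hnormalized := hinj (inv_degree_smul_mem_realization hnonneg_pos hpos_ne hσ hsupp_pos)
    (inv_degree_smul_mem_realization hnonneg_neg hneg_ne hτ hsupp_neg) himage
  rw [hdeg_eq] at hnormalized
  exact hparts <| smul_right_injective _
    (inv_ne_zero (degree_pos hnonneg_neg hneg_ne).ne') hnormalized

theorem not_isEmbeddingOf_of_same_side {ι : Type*} {s : Finset ι} {i₀ : ι} {B : ι → V} {P Q : V}
    {a : ι → ℝ} {μ : ℝ} {σ τ : Finset V} (hσ : σ ∈ K.faces) (hτ : τ ∈ K.faces) (hPσ : P ∈ σ)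
    (hBσ : ∀ i ∈ s, B i ∈ σ) (hQτ : Q ∈ τ) (hBτ : ∀ i ∈ s, B i ∈ τ) (hPQ : P ≠ Q)
    (hPB : ∀ i ∈ s, P ≠ B i) (hi₀ : i₀ ∈ s) (hμ : 0 ≤ μ) (ha : ∑ i ∈ s, a i = 1)
    (hπ : π P = ∑ i ∈ s, a i • π (B i) + μ • (π Q - π (B i₀))) : ¬ IsEmbeddingOf K π := by
  classical
  set x : V →₀ ℝ := Finsupp.single P 1 - ∑ i ∈ s, Finsupp.single (B i) (a i) -
    (Finsupp.single Q μ - Finsupp.single (B i₀) μ) with hx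
  have hx_off : ∀ v, (∀ i ∈ s, v ≠ B i) →
      x v = (if P = v then 1 else 0) - if Q = v then μ else 0 := by
    intro v hv
    have hsum : ∑ i ∈ s, (if B i = v then a i else 0) = 0 :=
      Finset.sum_eq_zero fun i hi => if_neg (hv i hi).symm
    simp [hx, Finsupp.single_apply, hsum, (hv i₀ hi₀).symm]
  refine not_isEmbeddingOf_of_affine_dependence (x := x) (fun h => ?_) ?_ ?_ hσ hτ
    (fun v hv => ?_) (fun v hv => ?_)
  · have hxP := hx_off P hPB
    simp [h, hPQ.symm] at hxP
  · simp [hx, ha]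
  · simp [hx, hπ, smul_sub]
  · by_contra hvσ
    rw [hx_off v (by rintro i hi rfl; exact hvσ (hBσ i hi)),
      if_neg (fun h : P = v => hvσ (h ▸ hPσ))] at hv
    split_ifs at hv <;> linarith
  · by_contra hvτ
    rw [hx_off v (by rintro i hi rfl; exact hvτ (hBτ i hi)),
      if_neg (fun h : Q = v => hvτ (h ▸ hQτ))] at hv
    split_ifs at hv <;> linarith

end AffineDependence

section KuhnSimplices

variable {d : ℕ}

theorem distort_sub (ε : ℝ) (x y : EuclideanSpace ℝ (Fin d)) :
    distort ε (x - y) = distort ε x - distort ε y := by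
  ext i
  simp only [distort, PiLp.sub_apply, Finset.sum_sub_distrib]
  ring

theorem distort_surjective {ε : ℝ} (hε : ε * d ≠ 2) :
    Function.Surjective (distort ε : EuclideanSpace ℝ (Fin d) → EuclideanSpace ℝ (Fin d)) := by
  intro g
  have hε' : 2 - ε * d ≠ 0 := sub_ne_zero.2 hε.symm
  refine ⟨WithLp.toLp 2 fun i => g i + ε / (2 - ε * d) * ∑ j, g j, ?_⟩
  ext i
  simp only [distort, Finset.sum_add_distrib, Finset.sum_const, Finset.card_univ,
    Fintype.card_fin, nsmul_eq_mul]
  field_simp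
  ring

theorem inner_distort_right (ε : ℝ) (x y : EuclideanSpace ℝ (Fin d)) :
    inner ℝ x (distort ε y) = inner ℝ (distort ε x) y := by
  simp only [PiLp.inner_apply, distort, RCLike.inner_apply, conj_trivial, sub_mul, mul_sub,
    Finset.sum_sub_distrib, ← Finset.mul_sum, ← Finset.sum_mul]
  ring

theorem sum_sum_sub_sq {ι R : Type*} [Fintype ι] [CommRing R] (x : ι → R) :
    ∑ i, ∑ j, (x i - x j) ^ 2 = 2 * (Fintype.card ι * ∑ i, x i ^ 2 - (∑ i, x i) ^ 2) := by
  simp only [sub_sq, Finset.sum_add_distrib, Finset.sum_sub_distrib, Finset.sum_const,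
    Finset.card_univ, nsmul_eq_mul, ← Finset.mul_sum, ← Finset.sum_mul]
  ring

theorem sum_sum_mul_sub_of_skew {ι R : Type*} [Fintype ι] [CommRing R] {τ : ι → ι → R}
    (hτ : ∀ i j, τ j i = -τ i j) (x : ι → R) :
    ∑ i, ∑ j, τ i j * (x i - x j) = 2 * ∑ i, (∑ j, τ i j) * x i := by
  have hswap : ∑ i, ∑ j, τ i j * x j = -∑ i, (∑ j, τ i j) * x i := by
    rw [Finset.sum_comm, ← Finset.sum_neg_distrib]
    refine Finset.sum_congr rfl fun j _ => ?_
    rw [Finset.sum_mul, ← Finset.sum_neg_distrib]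
    exact Finset.sum_congr rfl fun i _ => by rw [hτ j i, neg_mul]
  simp only [mul_sub, Finset.sum_sub_distrib, hswap, ← Finset.sum_mul]
  ring

theorem norm_distort_sq (ε : ℝ) (x : EuclideanSpace ℝ (Fin d)) :
    ‖distort ε x‖ ^ 2 = ∑ i, x i ^ 2 - ε * (1 - ε * d / 4) * (∑ i, x i) ^ 2 := by
  rw [EuclideanSpace.norm_sq_eq]
  simp only [distort, Real.norm_eq_abs, sq_abs, sub_sq, Finset.sum_add_distrib,
    Finset.sum_sub_distrib, Finset.sum_const, Finset.card_univ, Fintype.card_fin, nsmul_eq_mul,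
    ← Finset.mul_sum, ← Finset.sum_mul]
  ring

/-- The `k`-th vertex of the Kuhn simplex with top vertex `o`, whose coordinates are decreased one
at a time in the order prescribed by the permutation `ρ`. -/
def kuhnVertex (o : Fin d → ℤ) (ρ : Equiv.Perm (Fin d)) (k : ℕ) : Fin d → ℤ :=
  fun i => o i - if (ρ i : ℕ) < k then 1 else 0

theorem kuhnVertex_zero (o : Fin d → ℤ) (ρ : Equiv.Perm (Fin d)) : kuhnVertex o ρ 0 = o := by
  ext i
  simp [kuhnVertex]

/-- The antisymmetric sign matrix of the order in which `ρ` lists the coordinates. -/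
def orderSign (ρ : Equiv.Perm (Fin d)) (i j : Fin d) : ℤ := ((ρ i : ℤ) - ρ j).sign

theorem orderSign_swap (ρ : Equiv.Perm (Fin d)) (i j : Fin d) :
    orderSign ρ j i = -orderSign ρ i j := by
  rw [orderSign, orderSign, ← Int.sign_neg, neg_sub]

theorem orderSign_mul_le_sq (ρ : Equiv.Perm (Fin d)) (i j : Fin d) (v : ℤ) :
    orderSign ρ i j * v ≤ v ^ 2 := by
  have hv : v ≤ v ^ 2 := Int.le_self_sq v
  have hv' : -v ≤ v ^ 2 := (Int.le_self_sq (-v)).trans_eq (neg_sq v)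
  have := sq_nonneg v
  rcases Int.sign_trichotomy ((ρ i : ℤ) - ρ j) with h | h | h <;> rw [orderSign, h] <;> linarith

/-- With `c = ε (1 - ε d / 4)` and `u` the displacement of a distorted center from the one at the
top of a Kuhn simplex, the excess of its squared distance to the circumcenter of the distorted
simplex over the squared circumradius. -/
noncomputable def kuhnExcess (c : ℝ) (ρ : Equiv.Perm (Fin d)) (u : Fin d → ℤ) : ℝ :=
  (1 - c * d) * ∑ i, ((u i ^ 2 + u i : ℤ) : ℝ) +
    c / 2 * ∑ i, ∑ j, (((u i - u j) ^ 2 - orderSign ρ i j * (u i - u j) : ℤ) : ℝ)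

theorem kuhnExcess_nonneg {c : ℝ} (hc : 0 ≤ c) (hcd : c * d ≤ 1) (ρ : Equiv.Perm (Fin d))
    (u : Fin d → ℤ) : 0 ≤ kuhnExcess c ρ u := by
  have hu : ∀ i, 0 ≤ u i ^ 2 + u i := fun i => by
    have := (Int.le_self_sq (-u i)).trans_eq (neg_sq (u i))
    linarith
  refine add_nonneg (mul_nonneg (sub_nonneg.2 hcd) (Finset.sum_nonneg fun i _ => ?_))
    (mul_nonneg (by positivity) (Finset.sum_nonneg fun i _ => Finset.sum_nonneg fun j _ => ?_))
  · exact Int.cast_nonneg (hu i)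
  · exact Int.cast_nonneg (sub_nonneg.2 (orderSign_mul_le_sq ρ i j _))

theorem kuhnExcess_kuhnVertex_sub (c : ℝ) (o : Fin d → ℤ) (ρ : Equiv.Perm (Fin d)) (k : ℕ) :
    kuhnExcess c ρ (kuhnVertex o ρ k - o) = 0 := by
  have hu : ∀ i, (kuhnVertex o ρ k - o) i = -if (ρ i : ℕ) < k then 1 else 0 := fun i => by
    simp only [Pi.sub_apply, kuhnVertex]
    ring
  have hsq : ∀ i, (kuhnVertex o ρ k - o) i ^ 2 + (kuhnVertex o ρ k - o) i = 0 := fun i => by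
    rw [hu]
    split_ifs <;> norm_num
  have hpair : ∀ i j, ((kuhnVertex o ρ k - o) i - (kuhnVertex o ρ k - o) j) ^ 2 -
      orderSign ρ i j * ((kuhnVertex o ρ k - o) i - (kuhnVertex o ρ k - o) j) = 0 := fun i j => by
    rw [hu, hu, orderSign]
    split_ifs with hi hj hj
    · norm_num
    · rw [Int.sign_eq_neg_one_of_neg (by omega)]
      norm_num
    · rw [Int.sign_eq_one_of_pos (by omega)]
      norm_num
    · norm_num
  simp only [kuhnExcess, hsq, hpair, Int.cast_zero, Finset.sum_const_zero, mul_zero, add_zero]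

theorem norm_sub_distort_sq {ε c : ℝ} (hc : c = ε * (1 - ε * d / 4)) {ρ : Equiv.Perm (Fin d)}
    {y : EuclideanSpace ℝ (Fin d)}
    (hy : ∀ i, distort ε y i = (c / 2 * ∑ j, (orderSign ρ i j : ℝ)) - (1 - c * d) / 2)
    (u : Fin d → ℤ) :
    ‖y - distort ε (WithLp.toLp 2 fun i => (u i : ℝ))‖ ^ 2 = ‖y‖ ^ 2 + kuhnExcess c ρ u := by
  have hinner : inner ℝ (distort ε y) (WithLp.toLp 2 fun i => (u i : ℝ)) =
      c / 2 * ∑ i, (∑ j, (orderSign ρ i j : ℝ)) * u i - (1 - c * d) / 2 * ∑ i, (u i : ℝ) := by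
    simp only [PiLp.inner_apply, hy, RCLike.inner_apply, conj_trivial]
    rw [Finset.mul_sum, Finset.mul_sum, ← Finset.sum_sub_distrib]
    exact Finset.sum_congr rfl fun i _ => by ring
  have hexcess : kuhnExcess c ρ u = (1 - c * d) * (∑ i, (u i : ℝ) ^ 2 + ∑ i, (u i : ℝ)) +
      c / 2 * (2 * (d * ∑ i, (u i : ℝ) ^ 2 - (∑ i, (u i : ℝ)) ^ 2) -
        2 * ∑ i, (∑ j, (orderSign ρ i j : ℝ)) * u i) := by
    have hskew := sum_sum_mul_sub_of_skew (τ := fun i j => (orderSign ρ i j : ℝ))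
      (fun i j => by rw [orderSign_swap, Int.cast_neg]) (fun i => (u i : ℝ))
    have hsq := sum_sum_sub_sq fun i => (u i : ℝ)
    rw [Fintype.card_fin] at hsq
    rw [kuhnExcess, ← hskew, ← hsq]
    push_cast
    simp only [Finset.sum_add_distrib, Finset.sum_sub_distrib]
  rw [norm_sub_sq_real, inner_distort_right, norm_distort_sq, ← hc, hinner, hexcess]
  ring

theorem distort_center_sub (ε : ℝ) (z o : Fin d → ℤ) :
    distort ε (Box.pixel z).center - distort ε (Box.pixel o).center =
      distort ε (WithLp.toLp 2 fun i => ((z - o) i : ℝ)) := by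
  rw [← distort_sub]
  congr 1
  ext i
  simp only [Box.center, Box.pixel, PiLp.sub_apply, Pi.sub_apply]
  push_cast
  ring

theorem exists_forall_kuhnVertex_mem_distortedPixel {ε : ℝ} (hε0 : 0 ≤ ε) (hε : ε * d < 2)
    (o : Fin d → ℤ) (ρ : Equiv.Perm (Fin d)) :
    ∃ x, ∀ k, x ∈ distortedPixel ε (kuhnVertex o ρ k) := by
  set c : ℝ := ε * (1 - ε * d / 4) with hc
  have hc0 : 0 ≤ c := mul_nonneg hε0 (by linarith)
  have hcd : c * d ≤ 1 := by
    have hsq : 1 - c * d = (1 - ε * d / 2) ^ 2 := by rw [hc]; ring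
    linarith [sq_nonneg (1 - ε * d / 2)]
  obtain ⟨y, hy⟩ := distort_surjective hε.ne (WithLp.toLp 2 fun i : Fin d =>
    (c / 2 * ∑ j, (orderSign ρ i j : ℝ)) - (1 - c * d) / 2)
  have hdist : ∀ z : Fin d → ℤ,
      dist (distort ε (Box.pixel o).center + y) (distort ε (Box.pixel z).center) ^ 2 =
        ‖y‖ ^ 2 + kuhnExcess c ρ (z - o) := fun z => by
    rw [dist_eq_norm, ← norm_sub_distort_sq hc fun i => by rw [hy], ← distort_center_sub]
    congr 2
    abel
  refine ⟨distort ε (Box.pixel o).center + y, fun k z => le_of_sq_le_sq ?_ dist_nonneg⟩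
  rw [hdist, hdist, kuhnExcess_kuhnVertex_sub]
  linarith [kuhnExcess_nonneg hc0 hcd ρ (z - o)]

end KuhnSimplices

section AffineWeights

/-- The `j`-th coordinate, relative to the corner of a staggered grid, of the center of the cell of
side length `ℓ` that lies below the corner in the first `k` directions: in direction `k` the cell
starts at the corner, and in the later ones it reaches one unit above it. -/
noncomputable def cornerOffset (ℓ : ℝ) (k j : ℕ) : ℝ :=
  -(ℓ / 2) + (if k = j then ℓ else 0) + if k < j then 1 else 0

theorem sum_mul_cornerOffset (a L : ℕ → ℝ) {j m : ℕ} (hj : j ≤ m) :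
    ∑ k ∈ Finset.range (m + 1), a k * cornerOffset (L k) k j =
      a j * L j + ∑ k ∈ Finset.range j, a k - (∑ k ∈ Finset.range (m + 1), a k * L k) / 2 := by
  have hfilter : (Finset.range (m + 1)).filter (· < j) = Finset.range j := by
    ext k
    simp only [Finset.mem_filter, Finset.mem_range]
    omega
  simp only [cornerOffset, mul_add, mul_neg, mul_ite, mul_zero, mul_one, mul_div_assoc',
    Finset.sum_add_distrib, Finset.sum_neg_distrib, ← Finset.sum_div, Finset.sum_ite_eq',
    Finset.mem_range, if_pos (Nat.lt_succ_of_le hj), ← Finset.sum_filter, hfilter]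
  ring

variable {L : ℕ → ℝ}

/-- The product `(1 - 1 / L 0) ⋯ (1 - 1 / L (k - 1))`. By `sum_mul_cornerOffset`, weights `a` for
which the combination of the corner cells has all coordinates equal satisfy
`a k * L k + ∑ i < k, a i = t` for a constant `t`, whence `t - ∑ i < k, a i = t * decay L k`. -/
noncomputable def decay (L : ℕ → ℝ) (k : ℕ) : ℝ := ∏ i ∈ Finset.range k, (1 - 1 / L i)

theorem decay_zero (L : ℕ → ℝ) : decay L 0 = 1 := Finset.prod_range_zero _

theorem decay_div (L : ℕ → ℝ) (k : ℕ) : decay L k / L k = decay L k - decay L (k + 1) := by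
  rw [decay, decay, Finset.prod_range_succ]
  ring

theorem sum_decay_div (L : ℕ → ℝ) (j : ℕ) :
    ∑ k ∈ Finset.range j, decay L k / L k = 1 - decay L j := by
  simp only [decay_div, Finset.sum_range_sub', decay_zero]

theorem decay_nonneg (hL : ∀ k, 1 ≤ L k) (k : ℕ) : 0 ≤ decay L k :=
  Finset.prod_nonneg fun i _ => sub_nonneg.2 ((div_le_one (one_pos.trans_le (hL i))).2 (hL i))

theorem decay_antitone (hL : ∀ k, 1 ≤ L k) : Antitone (decay L) :=
  antitone_nat_of_succ_le fun k => by
    have := div_nonneg (decay_nonneg hL k) (zero_le_one.trans (hL k))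
    linarith [decay_div L k]

theorem decay_le_one (hL : ∀ k, 1 ≤ L k) (k : ℕ) : decay L k ≤ 1 :=
  (decay_antitone hL (Nat.zero_le k)).trans_eq (decay_zero L)

theorem one_sub_decay_mul_le (hL : ∀ k, 1 ≤ L k) {c : ℝ} {m : ℕ} (hc : ∀ k < m, c ≤ L k) :
    (1 - decay L m) * c ≤ m := by
  have hterm : ∀ k ∈ Finset.range m, decay L k / L k * c ≤ 1 := fun k hk => by
    have hLk : 0 < L k := one_pos.trans_le (hL k)
    calc decay L k / L k * c
        ≤ decay L k / L k * L k := mul_le_mul_of_nonneg_left (hc k (Finset.mem_range.1 hk))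
          (div_nonneg (decay_nonneg hL k) hLk.le)
      _ = decay L k := div_mul_cancel₀ _ hLk.ne'
      _ ≤ 1 := decay_le_one hL k
  rw [← sum_decay_div, Finset.sum_mul]
  simpa using Finset.sum_le_sum hterm

theorem sum_decay_le (hL : ∀ k, 1 ≤ L k) {c : ℝ} {m : ℕ} (hc : ∀ k < m, L k ≤ c) :
    ∑ k ∈ Finset.range m, decay L k ≤ c * (1 - decay L m) := by
  rw [← sum_decay_div, Finset.mul_sum]
  refine Finset.sum_le_sum fun k hk => ?_
  rw [← mul_div_assoc, le_div_iff₀ (one_pos.trans_le (hL k)), mul_comm]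
  exact mul_le_mul_of_nonneg_right (hc k (Finset.mem_range.1 hk)) (decay_nonneg hL k)

theorem mul_decay_le_sum (hL : ∀ k, 1 ≤ L k) (m : ℕ) :
    m * decay L m ≤ ∑ k ∈ Finset.range m, decay L k := by
  simpa using Finset.card_nsmul_le_sum (Finset.range m) (decay L) (decay L m)
    fun k hk => decay_antitone hL (Finset.mem_range.1 hk).le

theorem mul_decay_add_lt {s : ℝ} {m : ℕ} (hL : ∀ k, 1 ≤ L k)
    (hmono : MonotoneOn L (Set.Iic m)) (hs : 0 ≤ s)
    (hratio : (m + 1) * (s + m) < L 0 * (m - 1)) :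
    s * (decay L m + L m * (1 - decay L m)) <
      L m * (decay L m + ∑ k ∈ Finset.range m, decay L k - 2) := by
  have hL0 : ∀ k ≤ m, L 0 ≤ L k := fun k hk => hmono (Nat.zero_le m) hk (Nat.zero_le k)
  have hLm : 0 < L m := one_pos.trans_le (hL m)
  set r := decay L m
  set X := L m * (1 - r) with hX
  have hXm : X * L 0 ≤ L m * m := by
    rw [hX, mul_assoc]
    exact mul_le_mul_of_nonneg_left (one_sub_decay_mul_le hL fun k hk => hL0 k hk.le) hLm.le
  have hgap : s + (s + (m + 1)) * X < L m * (m - 1) := by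
    refine lt_of_mul_lt_mul_right (a := L 0) ?_ (zero_le_one.trans (hL 0))
    calc (s + (s + (m + 1)) * X) * L 0
        = s * L 0 + (s + (m + 1)) * (X * L 0) := by ring
      _ ≤ s * L m + (s + (m + 1)) * (L m * m) := by
        gcongr
        exact hL0 m le_rfl
      _ = L m * ((m + 1) * (s + m)) := by ring
      _ < L m * (L 0 * (m - 1)) := mul_lt_mul_of_pos_left hratio hLm
      _ = L m * (m - 1) * L 0 := by ring
  calc s * (r + X)
      ≤ s * (1 + X) := by gcongr; exact decay_le_one hL m
    _ < L m * (m - 1) - (m + 1) * X := by linarith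
    _ = L m * (r + m * r - 2) := by rw [hX]; ring
    _ ≤ L m * (r + ∑ k ∈ Finset.range m, decay L k - 2) := by
      gcongr
      exact mul_decay_le_sum hL m

/-- The weights, affine in the parameter `t`, of the combination of the corner cells `0, …, m` whose
coordinates `0, …, m - 1` relative to the corner are all equal. -/
noncomputable def facetWeight (L : ℕ → ℝ) (m : ℕ) (t : ℝ) (k : ℕ) : ℝ :=
  if k < m then t * (decay L k / L k) else 1 - t * (1 - decay L m)

theorem sum_facetWeight {j m : ℕ} (hj : j ≤ m) (t : ℝ) :
    ∑ k ∈ Finset.range j, facetWeight L m t k = t * (1 - decay L j) := by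
  rw [← sum_decay_div, Finset.mul_sum]
  exact Finset.sum_congr rfl fun k hk => if_pos ((Finset.mem_range.1 hk).trans_le hj)

theorem facetWeight_self (m : ℕ) (t : ℝ) : facetWeight L m t m = 1 - t * (1 - decay L m) :=
  if_neg (lt_irrefl m)

theorem facetWeight_mul {k m : ℕ} (hLk : L k ≠ 0) (hk : k < m) (t : ℝ) :
    facetWeight L m t k * L k = t * decay L k := by
  rw [facetWeight, if_pos hk, mul_assoc, div_mul_cancel₀ _ hLk]

theorem sum_facetWeight_mul {m : ℕ} (hL : ∀ k < m, L k ≠ 0) (t : ℝ) :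
    ∑ k ∈ Finset.range (m + 1), facetWeight L m t k * L k =
      L m - t * (L m * (1 - decay L m) - ∑ k ∈ Finset.range m, decay L k) := by
  rw [Finset.sum_range_succ, facetWeight_self, Finset.sum_congr rfl fun k hk =>
    facetWeight_mul (hL k (Finset.mem_range.1 hk)) (Finset.mem_range.1 hk) t, ← Finset.mul_sum]
  ring

theorem sum_facetWeight_mul_cornerOffset {j m : ℕ} (hL : ∀ k < m, L k ≠ 0) (hj : j ≤ m) (t : ℝ) :
    ∑ k ∈ Finset.range (m + 1), facetWeight L m t k * cornerOffset (L k) k j =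
      t - (∑ k ∈ Finset.range (m + 1), facetWeight L m t k * L k) / 2 -
        if j = m then t * decay L m - facetWeight L m t m * L m else 0 := by
  rw [sum_mul_cornerOffset _ _ hj, sum_facetWeight hj]
  rcases hj.lt_or_eq with hjm | rfl
  · rw [if_neg hjm.ne, facetWeight_mul (hL j hjm) hjm]
    ring
  · rw [if_pos rfl]
    ring

theorem exists_affine_weights_cornerOffset {s : ℝ} {m : ℕ} (hL : ∀ k, 1 ≤ L k)
    (hmono : MonotoneOn L (Set.Iic m)) (hs : 0 ≤ s)
    (hratio : (m + 1) * (s + m) < L 0 * (m - 1)) :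
    ∃ (a : ℕ → ℝ) (μ : ℝ), 0 ≤ μ ∧ ∑ k ∈ Finset.range (m + 1), a k = 1 ∧
      ∀ j ≤ m, cornerOffset s (m + 1) j =
        ∑ k ∈ Finset.range (m + 1), a k * cornerOffset (L k) k j + if j = m then μ else 0 := by
  have hL_ne : ∀ k < m, L k ≠ 0 := fun k _ => (one_pos.trans_le (hL k)).ne'
  set D := 2 + L m * (1 - decay L m) - ∑ k ∈ Finset.range m, decay L k with hD
  have hD_pos : 0 < D := by
    linarith [sum_decay_le hL fun k hk => hmono hk.le (Set.mem_Iic.2 le_rfl) hk.le]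
  set t := (L m - s) / D
  have htD : t * D = L m - s := div_mul_cancel₀ _ hD_pos.ne'
  refine ⟨facetWeight L m t, t * decay L m - facetWeight L m t m * L m, ?_, ?_, fun j hj => ?_⟩
  · have hμ : (t * decay L m - facetWeight L m t m * L m) * D =
        L m * (decay L m + ∑ k ∈ Finset.range m, decay L k - 2) -
          s * (decay L m + L m * (1 - decay L m)) := by
      rw [facetWeight_self]
      linear_combination (decay L m + L m * (1 - decay L m)) * htD - L m * hD
    refine nonneg_of_mul_nonneg_left ?_ hD_pos
    rw [hμ, sub_nonneg]
    exact (mul_decay_add_lt hL hmono hs hratio).le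
  · rw [Finset.sum_range_succ, sum_facetWeight le_rfl, facetWeight_self]
    ring
  · rw [sum_facetWeight_mul_cornerOffset hL_ne hj, sum_facetWeight_mul hL_ne, sub_add_cancel,
      cornerOffset, if_neg (by omega), if_neg (by omega)]
    linear_combination (-1 / 2) * htD + t / 2 * hD

end AffineWeights

section PixelPartitions

variable {d n : ℕ} {ε : ℝ} {R : Box d} {z z' : Fin d → ℤ}

/-- The pixel `z` is contained in the box `R`, in terms of coordinates. -/
def Box.HasPixel (R : Box d) (z : Fin d → ℤ) : Prop := ∀ i, R.lo i ≤ z i ∧ z i < R.hi i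

theorem Box.HasPixel.toSet_subset (h : R.HasPixel z) : (Box.pixel z).toSet ⊆ R.toSet :=
  fun _ hx i => ⟨(Int.cast_le.2 (h i).1).trans (hx i).1, (hx i).2.trans (Int.cast_le.2 (h i).2)⟩

theorem Box.HasPixel.distortedPixel_subset (h : R.HasPixel z) :
    distortedPixel ε z ⊆ distortedBox ε R := fun _ hx => ⟨z, h.toSet_subset, hx⟩

theorem Box.interior_toSet (R : Box d) :
    interior R.toSet = {x | ∀ i, (R.lo i : ℝ) < x i ∧ x i < (R.hi i : ℝ)} := by
  have htoSet : R.toSet = PiLp.homeomorph 2 (fun _ : Fin d => ℝ) ⁻¹'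
      Set.univ.pi fun i => Set.Icc (R.lo i : ℝ) (R.hi i : ℝ) :=
    Set.ext fun x => ⟨fun h i _ => h i, fun h i => h i trivial⟩
  rw [htoSet, ← Homeomorph.preimage_interior, interior_pi_set Set.finite_univ]
  simp only [interior_Icc]
  exact Set.ext fun x => ⟨fun h i => h i trivial, fun h i _ => h i⟩

theorem Box.hasPixel_floor_of_mem_interior {x : EuclideanSpace ℝ (Fin d)}
    (hx : x ∈ interior R.toSet) : R.HasPixel fun i => ⌊x i⌋ := by
  rw [Box.interior_toSet] at hx
  exact fun i => ⟨Int.le_floor.2 (hx i).1.le, Int.floor_lt.2 (hx i).2⟩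

theorem exists_mem_pixel_of_mem_bigCube (hn : 0 < n) {x : EuclideanSpace ℝ (Fin d)}
    (hx : x ∈ bigCube d n) :
    ∃ z : Fin d → ℤ, (∀ i, 0 ≤ z i ∧ z i < n) ∧ x ∈ (Box.pixel z).toSet := by
  refine ⟨fun i => min ⌊x i⌋ (n - 1), fun i => ⟨le_min (Int.floor_nonneg.2 (hx i).1) (by omega),
    Int.lt_of_le_sub_one (min_le_right _ _)⟩, fun i => ⟨?_, ?_⟩⟩
  · exact (Int.cast_le.2 (min_le_left _ _)).trans (Int.floor_le (x i))
  · simp only [Box.pixel]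
    rcases min_choice ⌊x i⌋ ((n : ℤ) - 1) with h | h <;> rw [h] <;> push_cast
    · exact (Int.lt_floor_add_one (x i)).le
    · simpa using (hx i).2

/-- The collection of all boxes that a rule `cell` assigns to the pixels of `[0, n]^d`. -/
noncomputable def cellPartition (cell : (Fin d → ℤ) → Box d) (n : ℕ) : Finset (Box d) :=
  open Classical in (Fintype.piFinset fun _ => Finset.Ico (0 : ℤ) n).image cell

variable {cell : (Fin d → ℤ) → Box d}

theorem mem_cellPartition :
    R ∈ cellPartition cell n ↔ ∃ z : Fin d → ℤ, (∀ i, 0 ≤ z i ∧ z i < n) ∧ cell z = R := by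
  classical
  simp [cellPartition]

theorem isPartition_cellPartition (hn : 0 < n) (hcell : ∀ z, (cell z).HasPixel z)
    (hcell_eq : ∀ z z', (cell z).HasPixel z' → cell z' = cell z)
    (hsub : ∀ z : Fin d → ℤ, (∀ i, 0 ≤ z i ∧ z i < n) → (cell z).toSet ⊆ bigCube d n) :
    IsPartition n (cellPartition cell n) where
  iUnion_eq := by
    refine Set.Subset.antisymm (Set.iUnion₂_subset fun R hR => ?_) fun x hx => ?_
    · obtain ⟨z, hz, rfl⟩ := mem_cellPartition.1 hR
      exact hsub z hz
    · obtain ⟨z, hz, hxz⟩ := exists_mem_pixel_of_mem_bigCube hn hx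
      exact Set.mem_iUnion₂.2 ⟨cell z, mem_cellPartition.2 ⟨z, hz, rfl⟩,
        (hcell z).toSet_subset hxz⟩
  disjoint := by
    intro R hR R' hR' hne
    obtain ⟨z, -, rfl⟩ := mem_cellPartition.1 hR
    obtain ⟨z', -, rfl⟩ := mem_cellPartition.1 hR'
    refine Set.disjoint_left.2 fun x hx hx' => hne ?_
    rw [← hcell_eq z _ (Box.hasPixel_floor_of_mem_interior hx),
      ← hcell_eq z' _ (Box.hasPixel_floor_of_mem_interior hx')]

theorem image_kuhnVertex_mem_faces [DecidableEq (Box d)] (hε0 : 0 ≤ ε) (hε : ε * d < 2)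
    (hcell : ∀ z, (cell z).HasPixel z) {o : Fin d → ℤ} (ho : ∀ i, 1 ≤ o i ∧ o i < n)
    (ρ : Equiv.Perm (Fin d)) {s : Finset ℕ} (hs : s.Nonempty) :
    s.image (fun k => cell (kuhnVertex o ρ k)) ∈ (dualComplex ε (cellPartition cell n)).faces := by
  obtain ⟨x, hx⟩ := exists_forall_kuhnVertex_mem_distortedPixel hε0 hε o ρ
  refine ⟨hs.image _, Finset.image_subset_iff.2 fun k _ => mem_cellPartition.2
    ⟨_, fun i => ?_, rfl⟩, x, ?_⟩
  · have := ho i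
    simp only [kuhnVertex]
    split_ifs <;> omega
  · simp only [Set.mem_iInter, Finset.mem_image]
    rintro _ ⟨k, -, rfl⟩
    exact (hcell _).distortedPixel_subset (hx k)

theorem balance_le {σ : Finset (Box d)} {β s : ℝ} (hβ : 0 ≤ β) (hs : 0 < s)
    (hσ : ∀ R ∈ σ, ∀ i, s ≤ R.length i ∧ R.length i ≤ β * s) : balance σ ≤ β := by
  rw [balance]
  set A := {l : ℝ | ∃ R ∈ σ, ∃ i, R.length i = l}
  have hA : ∀ l ∈ A, s ≤ l ∧ l ≤ β * s := by
    rintro _ ⟨R, hR, i, rfl⟩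
    exact hσ R hR i
  rcases A.eq_empty_or_nonempty with hempty | hne
  · simpa [hempty] using hβ
  · have hinf : s ≤ sInf A := le_csInf hne fun l hl => (hA l hl).1
    rw [div_le_iff₀ (hs.trans_le hinf)]
    exact (csSup_le hne fun l hl => (hA l hl).2).trans (mul_le_mul_of_nonneg_left hinf hβ)

end PixelPartitions

section GridBox

variable {d ℓ n : ℕ} (hℓ : 0 < ℓ) (z : Fin d → ℤ)

/-- The cube containing the pixel `z` in the grid of mesh `ℓ` with a node at the origin. -/
def gridBox : Box d where
  lo i := ℓ * (z i / ℓ)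
  hi i := ℓ * (z i / ℓ) + ℓ
  lo_lt_hi i := by omega

theorem hasPixel_gridBox : (gridBox hℓ z).HasPixel z := fun i =>
  have hℓ' : (0 : ℤ) < ℓ := by exact_mod_cast hℓ
  ⟨Int.mul_ediv_self_le hℓ'.ne', Int.lt_mul_ediv_self_add hℓ'⟩

theorem length_gridBox (i : Fin d) : (gridBox hℓ z).length i = ℓ := by
  simp [gridBox, Box.length]

variable {z}

theorem ediv_eq_of_hasPixel_gridBox {z' : Fin d → ℤ} (h : (gridBox hℓ z).HasPixel z')
    (i : Fin d) : z' i / ℓ = z i / ℓ := by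
  have := h i
  simp only [gridBox] at this
  rw [Int.ediv_eq_iff_of_pos (by exact_mod_cast hℓ)]
  constructor <;> linarith

theorem le_iff_le_of_hasPixel_gridBox {z' : Fin d → ℤ} (h : (gridBox hℓ z).HasPixel z')
    {t : ℤ} (ht : (ℓ : ℤ) ∣ t) (i : Fin d) : t ≤ z' i ↔ t ≤ z i := by
  obtain ⟨q, rfl⟩ := ht
  have hℓ' : (0 : ℤ) < ℓ := by exact_mod_cast hℓ
  rw [mul_comm, ← Int.le_ediv_iff_mul_le hℓ', ← Int.le_ediv_iff_mul_le hℓ',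
    ediv_eq_of_hasPixel_gridBox hℓ h]

theorem gridBox_eq_of_hasPixel {z' : Fin d → ℤ} (h : (gridBox hℓ z).HasPixel z') :
    gridBox hℓ z' = gridBox hℓ z := by
  ext i <;> simp only [gridBox, ediv_eq_of_hasPixel_gridBox hℓ h]

theorem toSet_gridBox_subset_bigCube (hn : ℓ ∣ n) (hz : ∀ i, 0 ≤ z i ∧ z i < n) :
    (gridBox hℓ z).toSet ⊆ bigCube d n := by
  intro x hx i
  obtain ⟨q, rfl⟩ := hn
  have hℓ' : (0 : ℤ) < ℓ := by exact_mod_cast hℓ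
  have hlo : 0 ≤ (gridBox hℓ z).lo i := mul_nonneg hℓ'.le (Int.ediv_nonneg (hz i).1 hℓ'.le)
  have hhi : (gridBox hℓ z).hi i ≤ (ℓ * q : ℕ) := by
    have hlt : z i / ℓ < q := Int.ediv_lt_of_lt_mul hℓ' (by
      rw [mul_comm]
      exact_mod_cast (hz i).2)
    calc (ℓ : ℤ) * (z i / ℓ) + ℓ = ℓ * (z i / ℓ + 1) := by ring
      _ ≤ ℓ * q := mul_le_mul_of_nonneg_left hlt hℓ'.le
      _ = (ℓ * q : ℕ) := (Nat.cast_mul ℓ q).symm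
  have hlo' : (0 : ℝ) ≤ (gridBox hℓ z).lo i := by exact_mod_cast hlo
  have hhi' : ((gridBox hℓ z).hi i : ℝ) ≤ (ℓ * q : ℕ) := by exact_mod_cast hhi
  exact ⟨hlo'.trans (hx i).1, (hx i).2.trans hhi'⟩

theorem center_gridBox_apply {t : ℤ} (ht : (ℓ : ℤ) ∣ t) {i : Fin d} (hle : t ≤ z i)
    (hlt : z i < t + ℓ) : (gridBox hℓ z).center i = t + (ℓ : ℝ) / 2 := by
  obtain ⟨q, rfl⟩ := ht
  have hq : z i / ℓ = q := by
    rw [Int.ediv_eq_iff_of_pos (by exact_mod_cast hℓ)]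
    constructor <;> linarith
  simp only [Box.center, gridBox, hq]
  push_cast
  ring

theorem center_gridBox_add_single {i : Fin d} (hi : (ℓ : ℤ) ∣ z i + 1) :
    (gridBox hℓ (z + Pi.single i 1)).center =
      (gridBox hℓ z).center + (ℓ : ℝ) • EuclideanSpace.single i 1 := by
  ext j
  rcases eq_or_ne j i with rfl | hj
  · rw [center_gridBox_apply hℓ hi (by simp) (by simpa using hℓ), PiLp.add_apply,
      center_gridBox_apply hℓ (hi.sub (dvd_refl (ℓ : ℤ))) (by omega) (by omega)]
    simp only [PiLp.smul_apply, PiLp.single_apply, if_true, smul_eq_mul, mul_one]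
    push_cast
    ring
  · simp [Box.center, gridBox, hj]

end GridBox

section StaggeredGrids

variable {d : ℕ} {o z z' : Fin d → ℤ} {L : ℕ → ℕ}

/-- The first direction in which the pixel `z` lies above the corner `o`, or `d` if there is none.
It groups the `2 ^ d` orthants at `o` into `d + 1` regions. -/
noncomputable def firstAbove (o z : Fin d → ℤ) : ℕ :=
  sInf {k | ∀ h : k < d, o ⟨k, h⟩ ≤ z ⟨k, h⟩}

theorem firstAbove_le (o z : Fin d → ℤ) : firstAbove o z ≤ d :=
  Nat.sInf_le fun h => absurd h (lt_irrefl d)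

theorem lt_of_lt_firstAbove {i : Fin d} (hi : (i : ℕ) < firstAbove o z) : z i < o i :=
  not_le.1 fun hle => Nat.notMem_of_lt_sInf hi fun _ => hle

theorem le_of_eq_firstAbove {i : Fin d} (hi : (i : ℕ) = firstAbove o z) : o i ≤ z i := by
  have hmem : firstAbove o z ∈ {k | ∀ h : k < d, o ⟨k, h⟩ ≤ z ⟨k, h⟩} :=
    Nat.sInf_mem ⟨d, fun h => absurd h (lt_irrefl d)⟩
  rw [← hi] at hmem
  exact hmem i.2

theorem firstAbove_eq {k : ℕ} (hk : k ≤ d) (hlt : ∀ i : Fin d, (i : ℕ) < k → z i < o i)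
    (hle : ∀ i : Fin d, (i : ℕ) = k → o i ≤ z i) : firstAbove o z = k := by
  refine le_antisymm (Nat.sInf_le fun h => hle ⟨k, h⟩ rfl) (not_lt.1 fun h => ?_)
  let i : Fin d := ⟨firstAbove o z, h.trans_le hk⟩
  exact (hlt i h).not_ge (le_of_eq_firstAbove rfl)

theorem firstAbove_of_le (h : o ≤ z) : firstAbove o z = 0 :=
  firstAbove_eq (Nat.zero_le d) (fun _ hi => absurd hi (Nat.not_lt_zero _)) fun i _ => h i

theorem firstAbove_kuhnVertex (o : Fin d → ℤ) {k : ℕ} (hk : k ≤ d) :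
    firstAbove o (kuhnVertex o 1 k) = k :=
  firstAbove_eq hk (fun i hi => by simp [kuhnVertex, hi]) fun i hi => by simp [kuhnVertex, hi]

/-- The grids of mesh `L 0, …, L d` with a node at the origin are staggered around the corner `o`:
in direction `i`, the grids of index at least `i` have a wall at `o`, those of smaller index have
one at distance `1` above it. -/
structure IsStaggered (o : Fin d → ℤ) (L : ℕ → ℕ) : Prop where
  dvd_of_le : ∀ k ≤ d, ∀ i : Fin d, (i : ℕ) ≤ k → (L k : ℤ) ∣ o i
  dvd_add_one_of_lt : ∀ (k : ℕ) (i : Fin d), k < i → (L k : ℤ) ∣ o i + 1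

variable (hL : ∀ k, 0 < L k)

/-- The cube containing the pixel `z` when, in each of the regions at the corner `o` that
`firstAbove o` distinguishes, the pixels are grouped along the grid of mesh `L k`. -/
noncomputable def gridCell (o : Fin d → ℤ) (z : Fin d → ℤ) : Box d :=
  gridBox (hL (firstAbove o z)) z

theorem gridCell_eq_gridBox {k : ℕ} (hk : firstAbove o z = k) :
    gridCell hL o z = gridBox (hL k) z := by
  subst hk
  rfl

theorem hasPixel_gridCell (o z : Fin d → ℤ) : (gridCell hL o z).HasPixel z :=
  hasPixel_gridBox (hL _) z

theorem length_gridCell (o z : Fin d → ℤ) (i : Fin d) :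
    (gridCell hL o z).length i = L (firstAbove o z) := length_gridBox (hL _) z i

theorem gridCell_eq_of_hasPixel (ho : IsStaggered o L) (h : (gridCell hL o z).HasPixel z') :
    gridCell hL o z' = gridCell hL o z := by
  have hiff : ∀ i : Fin d, (i : ℕ) ≤ firstAbove o z → (o i ≤ z' i ↔ o i ≤ z i) := fun i hi =>
    le_iff_le_of_hasPixel_gridBox _ h (ho.dvd_of_le _ (firstAbove_le o z) i hi) i
  have hfirst : firstAbove o z' = firstAbove o z := firstAbove_eq (firstAbove_le o z)
    (fun i hi => not_le.1 fun hle => (lt_of_lt_firstAbove hi).not_ge ((hiff i hi.le).1 hle))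
    (fun i hi => (hiff i hi.le).2 (le_of_eq_firstAbove hi))
  rw [gridCell_eq_gridBox hL hfirst]
  exact gridBox_eq_of_hasPixel _ h

theorem isPartition_gridCell (ho : IsStaggered o L) {n : ℕ} (hn : 0 < n)
    (hdvd : ∀ k ≤ d, L k ∣ n) : IsPartition n (cellPartition (gridCell hL o) n) :=
  isPartition_cellPartition hn (hasPixel_gridCell hL o) (fun _ _ => gridCell_eq_of_hasPixel hL ho)
    fun z => toSet_gridBox_subset_bigCube _ (hdvd _ (firstAbove_le o z))

theorem exists_length_eq_of_mem_cellPartition {n : ℕ} {R : Box d}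
    (hR : R ∈ cellPartition (gridCell hL o) n) : ∃ k ≤ d, ∀ i, R.length i = L k := by
  obtain ⟨z, -, rfl⟩ := mem_cellPartition.1 hR
  exact ⟨_, firstAbove_le o z, length_gridCell hL o z⟩

theorem isCubical_gridCell (o : Fin d → ℤ) (n : ℕ) :
    IsCubical (cellPartition (gridCell hL o) n) := by
  intro R hR i j
  obtain ⟨k, -, hk⟩ := exists_length_eq_of_mem_cellPartition hL hR
  rw [hk, hk]

theorem isBalanced_gridCell (o : Fin d → ℤ) (n : ℕ) (ε : ℝ) {β s : ℝ} (hβ : 0 ≤ β) (hs : 0 < s)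
    (hLs : ∀ k ≤ d, s ≤ L k ∧ L k ≤ β * s) :
    IsBalanced ε β (cellPartition (gridCell hL o) n) := by
  rintro σ ⟨-, hσ, -⟩
  refine balance_le hβ hs fun R hR i => ?_
  obtain ⟨k, hk, hlength⟩ := exists_length_eq_of_mem_cellPartition hL (hσ hR)
  rw [hlength]
  exact hLs k hk

theorem center_gridCell_kuhnVertex (ho : IsStaggered o L) {k : ℕ} (hk : k ≤ d) (i : Fin d) :
    (gridCell hL o (kuhnVertex o 1 k)).center i = o i + cornerOffset (L k) k i := by
  have hLk := hL k
  rw [gridCell_eq_gridBox hL (firstAbove_kuhnVertex o hk)]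
  rcases lt_trichotomy (i : ℕ) k with hi | hi | hi
  · have hz : kuhnVertex o 1 k i = o i - 1 := by simp [kuhnVertex, hi]
    rw [center_gridBox_apply _ ((ho.dvd_of_le k hk i hi.le).sub (dvd_refl (L k : ℤ))) (by omega)
      (by omega), cornerOffset, if_neg hi.ne', if_neg hi.not_gt]
    push_cast
    ring
  · have hz : kuhnVertex o 1 k i = o i := by simp [kuhnVertex, hi]
    rw [center_gridBox_apply _ (ho.dvd_of_le k hk i hi.le) hz.ge (by omega), cornerOffset,
      if_pos hi.symm, if_neg hi.not_gt]
    ring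
  · have hz : kuhnVertex o 1 k i = o i := by simp [kuhnVertex, hi.not_gt]
    rw [center_gridBox_apply _ ((ho.dvd_add_one_of_lt k i hi).sub (dvd_refl (L k : ℤ))) (by omega)
      (by omega), cornerOffset, if_neg hi.ne, if_pos hi]
    push_cast
    ring

theorem gridCell_add_single (o : Fin d → ℤ) (i : Fin d) :
    gridCell hL o (o + Pi.single i 1) = gridBox (hL 0) (o + Pi.single i 1) :=
  gridCell_eq_gridBox hL <| firstAbove_of_le <| le_add_of_nonneg_right <|
    Pi.single_nonneg.2 zero_le_one

theorem center_gridCell_add_single (ho : IsStaggered o L) {i : Fin d} (hi : 0 < (i : ℕ)) :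
    (gridCell hL o (o + Pi.single i 1)).center =
      (gridCell hL o (kuhnVertex o 1 0)).center + (L 0 : ℝ) • EuclideanSpace.single i 1 := by
  rw [gridCell_add_single, center_gridBox_add_single _ (ho.dvd_add_one_of_lt 0 i hi),
    kuhnVertex_zero, gridCell_eq_gridBox hL (firstAbove_of_le le_rfl)]

theorem kuhnVertex_add_single_finRotate {m : ℕ} (o : Fin (m + 1) → ℤ) {k : ℕ} (hk : k ≤ m) :
    kuhnVertex (o + Pi.single (Fin.last m) 1) (finRotate (m + 1)) (k + 1) = kuhnVertex o 1 k := by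
  ext i
  rcases eq_or_ne i (Fin.last m) with rfl | hi
  · simp [kuhnVertex, hk.not_gt]
  · have hlt : (finRotate (m + 1) i : ℕ) < k + 1 ↔ (i : ℕ) < k := by
      rw [coe_finRotate_of_ne_last hi, Nat.add_lt_add_iff_right]
    rw [kuhnVertex, kuhnVertex, Pi.add_apply, Pi.single_eq_of_ne hi, add_zero, if_congr hlt rfl rfl,
      Equiv.Perm.one_apply]

theorem one_lt_of_mul_lt_mul_sub_one {m : ℕ} {x y : ℝ} (hx : 0 ≤ x) (hy : 0 ≤ y)
    (h : (m + 1) * (x + m) < y * (m - 1)) : 1 < m := by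
  have hpos : 0 < y * ((m : ℝ) - 1) := lt_of_le_of_lt (by positivity) h
  exact_mod_cast sub_pos.1 (pos_of_mul_pos_right hpos hy)

theorem lt_of_mul_lt_mul_sub_one {m : ℕ} {x y : ℝ} (hx : 0 ≤ x) (hy : 0 ≤ y)
    (h : (m + 1) * (x + m) < y * (m - 1)) : x < y := by
  have hm : (1 : ℝ) < m := by exact_mod_cast one_lt_of_mul_lt_mul_sub_one hx hy h
  refine lt_of_mul_lt_mul_right (lt_of_le_of_lt ?_ h) (sub_pos.2 hm).le
  nlinarith

variable {m n : ℕ} {o : Fin (m + 1) → ℤ}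

theorem exists_affine_weights_center (ho : IsStaggered o L) (hmono : MonotoneOn L (Set.Iic m))
    (hratio : ((m : ℝ) + 1) * (L (m + 1) + m) < L 0 * (m - 1)) :
    ∃ (a : ℕ → ℝ) (μ : ℝ), 0 ≤ μ ∧ ∑ k ∈ Finset.range (m + 1), a k = 1 ∧
      (gridCell hL o (kuhnVertex o 1 (m + 1))).center =
        ∑ k ∈ Finset.range (m + 1), a k • (gridCell hL o (kuhnVertex o 1 k)).center +
          μ • ((gridCell hL o (o + Pi.single (Fin.last m) 1)).center -
            (gridCell hL o (kuhnVertex o 1 0)).center) := by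
  have hL0 : (L 0 : ℝ) ≠ 0 := by exact_mod_cast (hL 0).ne'
  have hm : 0 < m :=
    one_pos.trans (one_lt_of_mul_lt_mul_sub_one (Nat.cast_nonneg _) (Nat.cast_nonneg _) hratio)
  obtain ⟨a, μ, hμ, ha, hoffset⟩ := exists_affine_weights_cornerOffset (L := fun k => (L k : ℝ))
    (s := L (m + 1)) (m := m) (fun k => Nat.one_le_cast.2 (hL k))
    (fun i hi j hj hij => Nat.cast_le.2 (hmono hi hj hij)) (Nat.cast_nonneg _) hratio
  refine ⟨a, μ / L 0, by positivity, ha, ?_⟩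
  ext i
  have hsum : ∑ k ∈ Finset.range (m + 1), a k * (gridCell hL o (kuhnVertex o 1 k)).center i =
      o i + ∑ k ∈ Finset.range (m + 1), a k * cornerOffset (L k) k i := by
    rw [Finset.sum_congr rfl fun k hk => by
      rw [center_gridCell_kuhnVertex hL ho (Finset.mem_range.1 hk).le, mul_add],
      Finset.sum_add_distrib, ← Finset.sum_mul, ha, one_mul]
  have hsingle : (EuclideanSpace.single (Fin.last m) (1 : ℝ)) i = if (i : ℕ) = m then 1 else 0 := by
    simp [Fin.ext_iff]
  rw [center_gridCell_add_single hL ho (i := Fin.last m) hm, add_sub_cancel_left, smul_smul,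
    div_mul_cancel₀ _ hL0, center_gridCell_kuhnVertex hL ho le_rfl, hoffset i (Fin.is_le i)]
  simp only [PiLp.add_apply, WithLp.ofLp_sum, Finset.sum_apply, PiLp.smul_apply, smul_eq_mul, hsum,
    hsingle, mul_ite, mul_one, mul_zero, add_assoc]

theorem not_centerEmbeddable_gridCell (ho : IsStaggered o L)
    (hbounds : ∀ i, 1 ≤ o i ∧ o i + 1 < n) (hmono : MonotoneOn L (Set.Iic m))
    (hratio : ((m : ℝ) + 1) * (L (m + 1) + m) < L 0 * (m - 1)) {ε : ℝ} (hε0 : 0 ≤ ε)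
    (hε : ε * (m + 1 : ℕ) < 2) : ¬ CenterEmbeddable ε (cellPartition (gridCell hL o) n) := by
  classical
  set u := o + Pi.single (Fin.last m) 1 with hu
  have hu_le : o ≤ u := le_add_of_nonneg_right (Pi.single_nonneg.2 zero_le_one)
  have hu_lt : ∀ i, u i < n := fun i => (hbounds i).2.trans_le' <| by
    rw [hu, Pi.add_apply, Pi.single_apply]
    split_ifs <;> omega
  have hne : ∀ z, firstAbove o z ≤ m →
      gridCell hL o (kuhnVertex o 1 (m + 1)) ≠ gridCell hL o z := fun z hz h => by
    have hlength := length_gridCell hL o z 0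
    rw [← h, length_gridCell, firstAbove_kuhnVertex o le_rfl] at hlength
    have hlt := lt_of_mul_lt_mul_sub_one (Nat.cast_nonneg _) (Nat.cast_nonneg _) hratio
    have hle : (L 0 : ℝ) ≤ L (firstAbove o z) :=
      Nat.cast_le.2 (hmono (Nat.zero_le m) hz (Nat.zero_le _))
    exact (hlt.trans_le hle).ne hlength
  obtain ⟨a, μ, hμ, ha, hcenter⟩ := exists_affine_weights_center hL ho hmono hratio
  have hσ := image_kuhnVertex_mem_faces hε0 hε (hasPixel_gridCell hL o)
    (fun i => ⟨(hbounds i).1, (lt_add_one _).trans (hbounds i).2⟩) 1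
    (Finset.nonempty_range_add_one (n := m + 1))
  have hτ := image_kuhnVertex_mem_faces hε0 hε (hasPixel_gridCell hL o)
    (fun i => ⟨(hbounds i).1.trans (hu_le i), hu_lt i⟩) (finRotate (m + 1))
    (Finset.nonempty_range_add_one (n := m + 1))
  refine not_isEmbeddingOf_of_same_side (i₀ := 0) (B := fun k => gridCell hL o (kuhnVertex o 1 k))
    hσ hτ (Finset.mem_image_of_mem _ (Finset.self_mem_range_succ _))
    (fun k hk => Finset.mem_image_of_mem _ ?_) (Finset.mem_image.2 ⟨0, by simp, ?_⟩)
    (fun k hk => Finset.mem_image.2 ⟨k + 1, ?_, ?_⟩) (hne u ?_) (fun k hk => hne _ ?_) (by simp)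
    hμ ha hcenter
  · exact Finset.mem_range.2 ((Finset.mem_range.1 hk).trans (Nat.lt_succ_self _))
  · rw [kuhnVertex_zero]
  · simpa using hk
  · rw [kuhnVertex_add_single_finRotate o (Finset.mem_range_succ_iff.1 hk)]
  · rw [firstAbove_of_le hu_le]
    exact Nat.zero_le m
  · rw [firstAbove_kuhnVertex o (Finset.mem_range.1 hk).le]
    exact Finset.mem_range_succ_iff.1 hk

end StaggeredGrids

section CoprimeMeshes

theorem coprime_mul_factorial_add_one {x y M : ℕ} (hxy : x ≠ y) (hx : x ≤ M) (hy : y ≤ M) :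
    (x * M.factorial + 1).Coprime (y * M.factorial + 1) := by
  wlog hlt : x < y generalizing x y
  · exact (this hxy.symm hy hx (by omega)).symm
  · exact Nat.coprime_mul_succ (Nat.dvd_factorial (by omega) (by omega))

theorem exists_nat_ratio_lt {c β : ℝ} (hc : 0 ≤ c) (hβ : c < β) (D : ℕ) :
    ∃ a b : ℕ, c * a < b ∧ b + D ≤ β * a := by
  obtain ⟨a, ha⟩ := exists_nat_ge ((D + 1) / (β - c))
  rw [div_le_iff₀ (sub_pos.2 hβ)] at ha
  refine ⟨a, ⌊c * a⌋₊ + 1, by exact_mod_cast Nat.lt_floor_add_one (c * a), ?_⟩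
  have hfloor := Nat.floor_le (mul_nonneg hc a.cast_nonneg)
  push_cast
  linarith

theorem one_lt_of_add_one_div_sub_one_lt {x β : ℝ} (hx : 1 < x) (hβ : (x + 1) / (x - 1) < β) :
    1 < β :=
  ((one_lt_div (sub_pos.2 hx)).2 (by linarith)).trans hβ

theorem exists_injOn_nat_ratio_lt {m : ℕ} (hm : 1 < m) {β : ℝ}
    (hβ : ((m : ℝ) + 1) / (m - 1) < β) :
    ∃ q : ℕ → ℕ, Set.InjOn q (Set.Iic (m + 1)) ∧ MonotoneOn q (Set.Iic m) ∧
      (∀ k, q (m + 1) ≤ q k ∧ (q k : ℝ) ≤ β * q (m + 1)) ∧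
      ((m : ℝ) + 1) * q (m + 1) < q 0 * (m - 1) := by
  have hm' : (0 : ℝ) < m - 1 := sub_pos.2 (Nat.one_lt_cast.2 hm)
  have hβ1 := one_lt_of_add_one_div_sub_one_lt (Nat.one_lt_cast.2 hm) hβ
  obtain ⟨a, b, hab, hba⟩ := exists_nat_ratio_lt (by positivity) hβ m
  rw [div_mul_eq_mul_div, div_lt_iff₀ hm'] at hab
  have hlt : a < b := by
    exact_mod_cast (show (a : ℝ) < b by nlinarith [a.cast_nonneg (α := ℝ)])
  refine ⟨fun k => if k ≤ m then b + k else a, fun i hi j hj hij => ?_, fun i hi j hj hij => ?_,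
    fun k => ?_, by simpa using hab⟩
  · simp only [Set.mem_Iic] at hi hj
    dsimp only at hij
    split_ifs at hij <;> omega
  · simp only [if_pos (Set.mem_Iic.1 hi), if_pos (Set.mem_Iic.1 hj)]
    omega
  · dsimp only
    rw [if_neg (by omega : ¬ m + 1 ≤ m)]
    split_ifs with hk
    · have hk' : (k : ℝ) ≤ m := Nat.cast_le.2 hk
      push_cast
      exact ⟨by omega, by linarith⟩
    · exact ⟨le_rfl, le_mul_of_one_le_left a.cast_nonneg hβ1.le⟩

theorem exists_coprime_meshes {m : ℕ} (hm : 1 < m) {β : ℝ} (hβ : ((m : ℝ) + 1) / (m - 1) < β) :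
    ∃ L : ℕ → ℕ, (∀ k, 0 < L k) ∧
      (Set.Iic (m + 1)).Pairwise (fun i j => (L i).Coprime (L j)) ∧
      (∀ k, (L (m + 1) : ℝ) ≤ L k ∧ L k ≤ β * L (m + 1)) ∧
      MonotoneOn L (Set.Iic m) ∧ ((m : ℝ) + 1) * (L (m + 1) + m) < L 0 * (m - 1) := by
  have hβ1 := one_lt_of_add_one_div_sub_one_lt (Nat.one_lt_cast.2 hm) hβ
  obtain ⟨q, hinj, hmono, hbounds, hratio⟩ := exists_injOn_nat_ratio_lt hm hβ
  set M := ∑ k ∈ Finset.range (m + 2), q k + (m + 1) ^ 2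
  have hqM : ∀ k ≤ m + 1, q k ≤ M := fun k hk =>
    (Finset.single_le_sum (fun _ _ => Nat.zero_le _)
      (Finset.mem_range_succ_iff.2 hk)).trans (Nat.le_add_right _ _)
  refine ⟨fun k => q k * M.factorial + 1, fun _ => Nat.succ_pos _, fun i hi j hj hij =>
    coprime_mul_factorial_add_one (hinj.ne hi hj hij) (hqM i hi) (hqM j hj), fun k => ⟨?_, ?_⟩,
    fun i hi j hj hij => ?_, ?_⟩
  · have := (hbounds k).1
    dsimp only
    gcongr
  · have := mul_le_mul_of_nonneg_right (hbounds k).2 M.factorial.cast_nonneg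
    push_cast
    linarith
  · have := hmono hi hj hij
    dsimp only
    gcongr
  · have hfactorial : ((m : ℝ) + 1) ^ 2 ≤ M.factorial := by
      exact_mod_cast (Nat.le_add_left _ _).trans (Nat.self_le_factorial M)
    have hgap : ((m : ℝ) + 1) * q (m + 1) + 1 ≤ q 0 * (m - 1) := by
      have hnat : (m + 1) * q (m + 1) + q 0 < q 0 * m := by
        exact_mod_cast (show ((m : ℝ) + 1) * q (m + 1) + q 0 < q 0 * m by linarith)
      have hnat' : ((m : ℝ) + 1) * q (m + 1) + q 0 + 1 ≤ q 0 * m := by exact_mod_cast hnat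
      linarith
    have := mul_le_mul_of_nonneg_right hgap M.factorial.cast_nonneg
    push_cast
    nlinarith

theorem exists_isStaggered {d : ℕ} {L : ℕ → ℕ} (hL : ∀ k, 0 < L k)
    (hcoprime : (Set.Iic d).Pairwise fun i j => (L i).Coprime (L j)) :
    ∃ (n : ℕ) (o : Fin d → ℤ), 0 < n ∧ (∀ k ≤ d, L k ∣ n) ∧ (∀ i, 1 ≤ o i ∧ o i + 1 < n) ∧
      IsStaggered o L := by
  set P := ∏ k ∈ Finset.range (d + 1), L k
  have hP : 0 < P := Finset.prod_pos fun k _ => hL k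
  have hdvd : ∀ k ≤ d, L k ∣ P := fun k hk =>
    Finset.dvd_prod_of_mem _ (Finset.mem_range_succ_iff.2 hk)
  have hcrt : ∀ i : Fin d, ∃ x < P, ∀ k ≤ d, x ≡ if (i : ℕ) ≤ k then 0 else L k - 1 [MOD L k] := by
    intro i
    have hpairwise : Set.Pairwise (Finset.range (d + 1) : Set ℕ)
        (Function.onFun Nat.Coprime L) := fun j hj k hk =>
      hcoprime (by simpa [Nat.lt_succ_iff] using hj) (by simpa [Nat.lt_succ_iff] using hk)
    let x := Nat.chineseRemainderOfFinset (fun k => if (i : ℕ) ≤ k then 0 else L k - 1) L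
      (Finset.range (d + 1)) (fun k _ => (hL k).ne') hpairwise
    exact ⟨x, Nat.chineseRemainderOfFinset_lt_prod _ _ (fun k _ => (hL k).ne') hpairwise,
      fun k hk => x.2 k (Finset.mem_range_succ_iff.2 hk)⟩
  choose x hxP hx using hcrt
  refine ⟨3 * P, fun i => x i + P, by omega, fun k hk => (hdvd k hk).mul_left 3, fun i => ?_,
    fun k hk i hik => ?_, fun k i hik => ?_⟩
  · have := hxP i
    dsimp only
    omega
  · have hmod := hx i k hk
    rw [if_pos hik] at hmod
    exact_mod_cast (Nat.modEq_zero_iff_dvd.1 hmod).add (hdvd k hk)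
  · have hk : k ≤ d := (hik.trans i.2).le
    have hmod := (hx i k hk).add_right 1
    rw [if_neg (by omega), Nat.sub_add_cancel (hL k)] at hmod
    have hdvd_succ : L k ∣ x i + 1 :=
      Nat.modEq_zero_iff_dvd.1 (hmod.trans (Nat.modEq_zero_iff_dvd.2 dvd_rfl))
    have := hdvd_succ.add (hdvd k hk)
    rw [add_right_comm] at this
    exact_mod_cast this

end CoprimeMeshes

end CubicalDual

open CubicalDual in
theorem mainTheorem5 (d : ℕ) (hd : 3 ≤ d) (β : ℝ) (hβ : (d : ℝ) / ((d : ℝ) - 2) < β) :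
    ∃ (n : ℕ) (C : Finset (CubicalDual.Box d)),
      0 < n ∧ CubicalDual.IsPartition n C ∧ CubicalDual.IsCubical C ∧
        ∀ ε : ℝ, 0 < ε → ε < 2 / (d : ℝ) →
          CubicalDual.IsBalanced ε β C ∧ ¬ CubicalDual.CenterEmbeddable ε C := by
  obtain ⟨m, rfl⟩ : ∃ m, d = m + 1 := ⟨d - 1, by omega⟩
  have hm : 1 < m := by omega
  have hβm : ((m : ℝ) + 1) / (m - 1) < β := by
    convert hβ using 2 <;> push_cast <;> ring
  have hβ0 : 0 ≤ β :=
    zero_le_one.trans (one_lt_of_add_one_div_sub_one_lt (Nat.one_lt_cast.2 hm) hβm).le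
  obtain ⟨L, hL, hcoprime, hbalance, hmono, hratio⟩ := exists_coprime_meshes hm hβm
  obtain ⟨n, o, hn, hdvd, hbounds, ho⟩ := exists_isStaggered hL hcoprime
  refine ⟨n, cellPartition (gridCell hL o) n, hn, isPartition_gridCell hL ho hn hdvd,
    isCubical_gridCell hL o n, fun ε hε0 hε => ⟨?_, ?_⟩⟩
  · exact isBalanced_gridCell hL o n ε hβ0 (Nat.cast_pos.2 (hL (m + 1))) fun k _ => hbalance k
  · exact not_centerEmbeddable_gridCell hL ho hbounds hmono hratio hε0.le
      ((lt_div_iff₀ (Nat.cast_pos.2 m.succ_pos)).1 hε)
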